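/- Let $X=(X_t)_{t\ge 0}$ be a real-valued Lévy process on a filtered probability space $(\Omega,\mathcal F,(\mathcal F_t)_{t\ge0},\mathbb Q)$: $X$ is adapted and càdlàg, $X_0=0$, and for $0\le s<t$ the increment $X_t-X_s$ is independent of $\mathcal F_s$ with a law that depends only on $t-s$. Let $h(y)=y\mathbf 1_{\{|y|<1\}}$, and let $(\mu,\sigma,\Pi)$ be the characteristic triplet of $X$, that is, $\mu\in\mathbb R$, $\sigma\ge 0$, $\Pi$ is a Lévy measure ($\Pi(\{0\})=0$ and $\int_{\mathbb R}(1\wedge y^2)\,\Pi(dy)<\infty$), and $E e^{iqX_t}=e^{t\psi(q)}$ for all $q\in\mathbb R$, $t\ge0$, where $$\psi(z)=i\mu z-\tfrac12\sigma^2z^2+\int_{\mathbb R}\bigl(e^{izy}-1-izh(y)\bigr)\,\Pi(dy)$$ for every $z\in\mathbb C$ for which the integral converges absolutely. Suppose that $\Pi(dy)=e^{\beta y}\,\Pi_0(dy)$, where $\beta\in\mathbb R$, $\beta\ne-\tfrac12$, and $\Pi_0$ is a symmetric positive measure on $\mathbb R$, i.e. $\Pi_0(dy)=\Pi_0(-dy)$.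 Then the integral defining $\psi(2\beta i)$ converges absolutely, the number $$\alpha:=\begin{cases}-\dfrac{\psi(2\beta i)}{2\beta}, & \beta\ne 0,\\[2mm] \mu, & \beta=0,\end{cases}$$ is real, and for every $S_0>0$, every $T\ge0$ and every nonnegative Borel function $f:\mathbb R\to\mathbb R$, with $S_t=S_0e^{X_t}$, $$E f(S_T)=E\left[\left(\frac{S_T}{S_0e^{\alpha T}}\right)^{-2\beta} f\left(\frac{S_0^2e^{2\alpha T}}{S_T}\right)\right],$$ as an equality in $[0,\infty]$ (both sides may be $+\infty$). -/

import Mathlib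

open MeasureTheory ProbabilityTheory Filter Topology
open scoped NNReal ENNReal

noncomputable section

namespace LevyMarket

/-- A real-valued Lévy process `X` on a stochastic basis `(Ω, m, ℱ, Q)`: adapted, starting at `0`,
with càdlàg paths, increments independent of the past, and the law of `X_t - X_s` depending only
on `t - s`. -/
structure IsLevyProcess {Ω : Type*} {m : MeasurableSpace Ω} (ℱ : Filtration ℝ≥0 m)
    (Q : Measure Ω) (X : ℝ≥0 → Ω → ℝ) : Prop where
  adapted : Adapted ℱ X
  start_zero : ∀ᵐ ω ∂Q, X 0 ω = 0
  cadlag : ∀ᵐ ω ∂Q, ∀ t : ℝ≥0,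
    ContinuousWithinAt (fun s => X s ω) (Set.Ici t) t ∧
      ∃ l : ℝ, Tendsto (fun s => X s ω) (𝓝[<] t) (𝓝 l)
  indep_past : ∀ s t : ℝ≥0, s < t →
    Indep (MeasurableSpace.comap (fun ω => X t ω - X s ω) inferInstance) (ℱ s) Q
  stationary : ∀ s s' h : ℝ≥0,
    IdentDistrib (fun ω => X (s + h) ω - X s ω) (fun ω => X (s' + h) ω - X s' ω) Q Q

/-- The truncation function `h(y) = y 1_{|y| < 1}`. -/
def trunc (y : ℝ) : ℝ := if |y| < 1 then y else 0

/-- A Lévy measure: a measure on `ℝ` without mass at `0` and with `∫ (1 ∧ y²) Π(dy) < ∞`. -/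
structure IsLevyMeasure (Pi : Measure ℝ) : Prop where
  zero_singleton : Pi {0} = 0
  lintegral_lt_top : ∫⁻ y, ENNReal.ofReal (min 1 (y ^ 2)) ∂Pi < ∞

/-- The integrand `e^{izy} - 1 - i z h(y)` of the Lévy–Khintchine formula. -/
def lkIntegrand (z : ℂ) (y : ℝ) : ℂ :=
  Complex.exp (Complex.I * z * y) - 1 - Complex.I * z * (trunc y : ℂ)

/-- The characteristic exponent
`ψ(z) = i a z - σ² z² / 2 + ∫ (e^{izy} - 1 - i z h(y)) Π(dy)` at a complex argument `z`.
It is meaningful at those `z` for which `lkIntegrand z` is `Π`-integrable. -/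
def charExponent (a σ : ℝ) (Pi : Measure ℝ) (z : ℂ) : ℂ :=
  Complex.I * a * z - (σ : ℂ) ^ 2 * z ^ 2 / 2 + ∫ y, lkIntegrand z y ∂Pi

/-- `X` has characteristic triplet `(a, σ, Π)` under `Q` (`σ ≥ 0` is the standard deviation of the
Gaussian part): `Π` is a Lévy measure and `E e^{iqX_t} = e^{tψ(q)}` for all real `q`, `t ≥ 0`. -/
structure HasTriplet {Ω : Type*} {m : MeasurableSpace Ω} (Q : Measure Ω) (X : ℝ≥0 → Ω → ℝ)
    (a σ : ℝ) (Pi : Measure ℝ) : Prop where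
  sigma_nonneg : 0 ≤ σ
  levyMeasure : IsLevyMeasure Pi
  charFun_eq : ∀ (t : ℝ≥0) (q : ℝ),
    ∫ ω, Complex.exp (Complex.I * q * (X t ω : ℂ)) ∂Q =
      Complex.exp ((t : ℝ) * charExponent a σ Pi q)

/-- A measure on `ℝ` is symmetric if `Π₀(dy) = Π₀(-dy)`. -/
def IsSymmetricMeasure (Pi₀ : Measure ℝ) : Prop := Pi₀.map (fun y => -y) = Pi₀

/-- The measure `e^{βy} Π₀(dy)`. -/
def expTilt (β : ℝ) (Pi₀ : Measure ℝ) : Measure ℝ :=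
  Pi₀.withDensity (fun y => ENNReal.ofReal (Real.exp (β * y)))

/-- The stock price `S_t = S₀ e^{X_t}`. -/
def stock {Ω : Type*} (S₀ : ℝ) (X : ℝ≥0 → Ω → ℝ) (t : ℝ≥0) (ω : Ω) : ℝ :=
  S₀ * Real.exp (X t ω)

end LevyMarket

end

/-
Call a law `ν` tilt-symmetric if `e^{-bx} ν(dx)` is symmetric, that is, if reflecting `ν` amounts to
multiplying it by `e^{-2bx}`. Tilting and reflecting both commute with convolution, so the class is
closed under convolution, and hence contains the compound Poisson law of every finite tilt-symmetric
jump measure; it contains the Gaussian laws `N(bv, v)`; and testing against compactly supported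
functions shows that it is closed under weak limits. The law of `X_T - αT` is the weak limit of such
laws obtained by discarding the jumps of size below `1/(n+1)`: the number `α` is exactly the drift
left over when the truncation `h` in the Lévy–Khintchine formula is replaced by its
tilt-symmetrisation `h(y)(1 - e^{-2by})/2`, which is integrable near `0`, and applying `ψ` to `2bi`
gives `-2bα`. The asserted identity is tilt-symmetry of that limit law, written in terms of `S_T`.
-/

namespace LevyMarket

section Tilt

theorem map_withDensity_comp {α β : Type*} [MeasurableSpace α] [MeasurableSpace β] (μ : Measure α)
    {φ : α → β} (hφ : Measurable φ) {f : β → ℝ≥0∞} (hf : Measurable f) :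
    (μ.withDensity (f ∘ φ)).map φ = (μ.map φ).withDensity f := by
  ext s hs
  rw [Measure.map_apply hφ hs, withDensity_apply _ (hφ hs), withDensity_apply _ hs,
    setLIntegral_map hs hf hφ, Function.comp_def]

variable (c d : ℝ) (ν ρ : Measure ℝ)

instance [IsLocallyFiniteMeasure ν] : IsLocallyFiniteMeasure (expTilt c ν) :=
  IsLocallyFiniteMeasure.withDensity_ofReal (by fun_prop)

theorem expTilt_expTilt : expTilt c (expTilt d ν) = expTilt (d + c) ν := by
  rw [expTilt, expTilt, ← withDensity_mul _ (by fun_prop) (by fun_prop)]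
  congr with x
  rw [Pi.mul_apply, ← ENNReal.ofReal_mul (Real.exp_nonneg _), ← Real.exp_add, ← add_mul]

theorem expTilt_restrict {s : Set ℝ} (hs : MeasurableSet s) :
    expTilt c (ν.restrict s) = (expTilt c ν).restrict s :=
  (restrict_withDensity hs _).symm

theorem expTilt_conv [SFinite ρ] : expTilt c (ν ∗ ρ) = expTilt c ν ∗ expTilt c ρ := by
  rw [Measure.conv, Measure.conv, expTilt, expTilt, expTilt,
    prod_withDensity (by fun_prop) (by fun_prop),
    ← map_withDensity_comp (φ := fun p : ℝ × ℝ ↦ p.1 + p.2)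
      (f := fun x ↦ ENNReal.ofReal (Real.exp (c * x))) _ (by fun_prop) (by fun_prop)]
  congr 2 with p
  rw [Function.comp_apply, mul_add, Real.exp_add, ENNReal.ofReal_mul (Real.exp_nonneg _)]

theorem map_neg_expTilt :
    (expTilt c ν).map (fun x ↦ -x) = expTilt (-c) (ν.map (fun x ↦ -x)) := by
  rw [expTilt, expTilt, ← map_withDensity_comp _ measurable_neg (by fun_prop)]
  congr with x
  simp

theorem lintegral_expTilt {g : ℝ → ℝ≥0∞} (hg : Measurable g) :
    ∫⁻ x, g x ∂expTilt c ν = ∫⁻ x, ENNReal.ofReal (Real.exp (c * x)) * g x ∂ν :=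
  lintegral_withDensity_eq_lintegral_mul _ (by fun_prop) hg

theorem integral_expTilt (g : ℝ → ℝ) :
    ∫ x, g x ∂expTilt c ν = ∫ x, Real.exp (c * x) * g x ∂ν := by
  rw [expTilt, integral_withDensity_eq_integral_toReal_smul (by fun_prop) (by simp)]
  simp only [ENNReal.toReal_ofReal (Real.exp_nonneg _), smul_eq_mul]

end Tilt

/-- The measure `e^{-bx} ν(dx)` is symmetric. The condition is imposed on `ν` itself: its reflection
is `e^{-2bx} ν(dx)`. -/
def IsTiltSymmetric (b : ℝ) (ν : Measure ℝ) : Prop :=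
  ν.map (fun x ↦ -x) = expTilt (-2 * b) ν

theorem IsSymmetricMeasure.isTiltSymmetric_expTilt {ν : Measure ℝ} (h : IsSymmetricMeasure ν)
    (b : ℝ) : IsTiltSymmetric b (expTilt b ν) := by
  rw [IsTiltSymmetric, map_neg_expTilt, h, expTilt_expTilt]
  ring_nf

namespace IsTiltSymmetric

variable {b : ℝ} {ν ρ : Measure ℝ}

theorem lintegral_comp_neg (h : IsTiltSymmetric b ν) {g : ℝ → ℝ≥0∞} (hg : Measurable g) :
    ∫⁻ x, g (-x) ∂ν = ∫⁻ x, ENNReal.ofReal (Real.exp (-2 * b * x)) * g x ∂ν := by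
  rw [← lintegral_expTilt _ _ hg, ← h, lintegral_map hg measurable_neg]

theorem integral_comp_neg (h : IsTiltSymmetric b ν) (g : ℝ → ℝ) :
    ∫ x, g (-x) ∂ν = ∫ x, Real.exp (-2 * b * x) * g x ∂ν := by
  rw [← integral_expTilt, ← h]
  exact (integral_map_equiv (MeasurableEquiv.neg ℝ) g).symm

theorem integral_eq_zero (h : IsTiltSymmetric b ν) {g : ℝ → ℝ}
    (hg : ∀ x, Real.exp (-2 * b * x) * g (-x) = -g x) : ∫ x, g x ∂ν = 0 := by
  have key := h.integral_comp_neg fun x ↦ g (-x)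
  simp only [neg_neg, hg, integral_neg] at key
  linarith

theorem integrable_exp [IsFiniteMeasure ν] (h : IsTiltSymmetric b ν) :
    Integrable (fun x ↦ Real.exp (-2 * b * x)) ν := by
  refine ⟨by fun_prop, ?_⟩
  rw [hasFiniteIntegral_iff_ofReal (ae_of_all _ fun _ ↦ Real.exp_nonneg _)]
  calc ∫⁻ x, ENNReal.ofReal (Real.exp (-2 * b * x)) ∂ν = ν Set.univ := by
        simpa using (h.lintegral_comp_neg measurable_one).symm
    _ < ∞ := measure_lt_top _ _

theorem dirac_zero (b : ℝ) : IsTiltSymmetric b (Measure.dirac 0) := by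
  rw [IsTiltSymmetric, Measure.map_dirac' measurable_neg, expTilt, dirac_withDensity]
  simp

theorem smul (h : IsTiltSymmetric b ν) (c : ℝ≥0∞) : IsTiltSymmetric b (c • ν) := by
  rw [IsTiltSymmetric, Measure.map_smul, h, expTilt, expTilt, withDensity_smul_measure]

theorem sum {ι : Type*} {ν : ι → Measure ℝ} (h : ∀ i, IsTiltSymmetric b (ν i)) :
    IsTiltSymmetric b (Measure.sum ν) := by
  rw [IsTiltSymmetric, Measure.map_sum (by fun_prop), expTilt, withDensity_sum]
  exact congrArg Measure.sum (funext h)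

theorem conv [SFinite ν] [SFinite ρ] (hν : IsTiltSymmetric b ν) (hρ : IsTiltSymmetric b ρ) :
    IsTiltSymmetric b (ν ∗ ρ) := by
  have hmap := Measure.map_conv_addMonoidHom (μ := ν) (ν := ρ) (negAddMonoidHom (α := ℝ))
    measurable_neg
  rw [IsTiltSymmetric, expTilt_conv, ← hν, ← hρ]
  exact hmap

theorem restrict (h : IsTiltSymmetric b ν) {s : Set ℝ} (hs : MeasurableSet s)
    (hneg : (fun x ↦ -x) ⁻¹' s = s) : IsTiltSymmetric b (ν.restrict s) := by
  have hmap := Measure.restrict_map (μ := ν) measurable_neg hs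
  rw [hneg] at hmap
  rw [IsTiltSymmetric, expTilt_restrict _ _ hs, ← h, ← hmap]

theorem gaussianReal (b : ℝ) (v : ℝ≥0) :
    IsTiltSymmetric b (ProbabilityTheory.gaussianReal (b * v) v) := by
  by_cases hv : v = 0
  · simpa [hv] using dirac_zero b
  rw [IsTiltSymmetric, gaussianReal_map_neg, gaussianReal_of_var_ne_zero _ hv,
    gaussianReal_of_var_ne_zero _ hv, expTilt, ← withDensity_mul _ (by fun_prop) (by fun_prop)]
  congr with x
  simp only [Pi.mul_apply, gaussianPDF, gaussianPDFReal]
  rw [← ENNReal.ofReal_mul (by positivity), mul_assoc _ (Real.exp _) (Real.exp _), ← Real.exp_add]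
  congr 3
  have : (v : ℝ) ≠ 0 := by exact_mod_cast hv
  field_simp
  ring

theorem of_tendsto {ι : Type*} {l : Filter ι} [l.NeBot] {νs : ι → ProbabilityMeasure ℝ}
    {ν : ProbabilityMeasure ℝ} (hlim : Tendsto νs l (𝓝 ν))
    (h : ∀ i, IsTiltSymmetric b (νs i : Measure ℝ)) : IsTiltSymmetric b (ν : Measure ℝ) := by
  have : IsProbabilityMeasure ((ν : Measure ℝ).map fun x ↦ -x) :=
    Measure.isProbabilityMeasure_map (by fun_prop)
  rw [ProbabilityMeasure.tendsto_iff_forall_integral_tendsto] at hlim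
  refine Measure.ext_of_integral_eq_on_compactlySupported fun f ↦ ?_
  rw [integral_map (by fun_prop) (by fun_prop), integral_expTilt]
  let tilted : BoundedContinuousFunction ℝ ℝ := ofCompactSupport
    (fun x ↦ Real.exp (-2 * b * x) * f x) (by fun_prop) f.hasCompactSupport.mul_left
  refine tendsto_nhds_unique
    (hlim ((f : BoundedContinuousFunction ℝ ℝ).compContinuous ⟨_, continuous_neg⟩))
    ((hlim tilted).congr fun i ↦ ((h i).integral_comp_neg f).symm)

end IsTiltSymmetric

section CompoundPoisson

/-- The `n`-fold convolution of a measure with itself. -/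
noncomputable def convPow {M : Type*} [AddMonoid M] [MeasurableSpace M] (ν : Measure M) :
    ℕ → Measure M
  | 0 => Measure.dirac 0
  | n + 1 => convPow ν n ∗ ν

/-- The compound Poisson law with finite jump measure `ν`, that is, the law of the sum of a
Poisson number of independent jumps, where `ν` carries both the jump rate (its mass) and the jump
law. -/
noncomputable def compoundPoisson {M : Type*} [AddMonoid M] [MeasurableSpace M] (ν : Measure M) :
    Measure M :=
  Measure.sum fun n ↦
    ENNReal.ofReal (Real.exp (-ν.real Set.univ) / n.factorial) • convPow ν n

section Mass

variable {M : Type*} [AddMonoid M] [MeasurableSpace M] [MeasurableAdd₂ M] (ν : Measure M)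
  [IsFiniteMeasure ν]

instance (n : ℕ) : IsFiniteMeasure (convPow ν n) := by
  induction n with
  | zero => exact inferInstanceAs (IsFiniteMeasure (Measure.dirac 0))
  | succ n ih => exact inferInstanceAs (IsFiniteMeasure (convPow ν n ∗ ν))

theorem convPow_univ (n : ℕ) : convPow ν n Set.univ = ν Set.univ ^ n := by
  induction n with
  | zero => simp [convPow]
  | succ n ih =>
    rw [convPow, Measure.conv, Measure.map_apply measurable_add MeasurableSet.univ,
      Set.preimage_univ, ← Set.univ_prod_univ, Measure.prod_prod, ih, pow_succ]

instance : IsProbabilityMeasure (compoundPoisson ν) := by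
  have hsum : HasSum
      (fun n : ℕ ↦ Real.exp (-ν.real Set.univ) * ν.real Set.univ ^ n / n.factorial) 1 :=
    hasSum_one_poissonMeasure (ν Set.univ).toNNReal
  have hterm : ∀ n : ℕ, ENNReal.ofReal (Real.exp (-ν.real Set.univ) / n.factorial) *
      ν Set.univ ^ n = ENNReal.ofReal
        (Real.exp (-ν.real Set.univ) * ν.real Set.univ ^ n / n.factorial) := fun n ↦ by
    rw [← ofReal_measureReal (μ := ν) (s := Set.univ), ← ENNReal.ofReal_pow measureReal_nonneg,
      ← ENNReal.ofReal_mul (by positivity), div_mul_eq_mul_div]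
  constructor
  rw [compoundPoisson, Measure.sum_apply _ MeasurableSet.univ]
  simp only [Measure.smul_apply, smul_eq_mul, convPow_univ, hterm]
  rw [← ENNReal.ofReal_tsum_of_nonneg (fun n ↦ by positivity) hsum.summable, ← ENNReal.ofReal_one]
  exact congrArg ENNReal.ofReal hsum.tsum_eq

end Mass

section CharFun

variable {E : Type*} [NormedAddCommGroup E] [InnerProductSpace ℝ E] [MeasurableSpace E]
  [BorelSpace E] [SecondCountableTopology E] (ν : Measure E) [IsFiniteMeasure ν]

theorem charFun_convPow (n : ℕ) (t : E) : charFun (convPow ν n) t = charFun ν t ^ n := by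
  induction n with
  | zero => simp [convPow]
  | succ n ih => rw [convPow, charFun_conv, ih, pow_succ]

theorem charFun_compoundPoisson (t : E) :
    charFun (compoundPoisson ν) t = Complex.exp (charFun ν t - ν.real Set.univ) := by
  have hint : Integrable (fun x ↦ Complex.exp (inner ℝ x t * Complex.I)) (compoundPoisson ν) :=
    (integrable_const (1 : ℝ)).mono (by fun_prop) (by simp)
  have hexp := (NormedSpace.expSeries_div_hasSum_exp (charFun ν t)).mul_left
    (Complex.exp (-ν.real Set.univ))
  rw [← Complex.exp_eq_exp_ℂ, ← Complex.exp_add, neg_add_eq_sub] at hexp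
  refine (hasSum_integral_measure hint).unique (hexp.congr_fun fun n ↦ ?_)
  rw [integral_smul_measure, ← charFun_apply, charFun_convPow,
    ENNReal.toReal_ofReal (by positivity), Complex.real_smul]
  push_cast
  ring

end CharFun

theorem integrable_exp_I_mul (ν : Measure ℝ) [IsFiniteMeasure ν] (q : ℝ) :
    Integrable (fun x : ℝ ↦ Complex.exp (Complex.I * q * x)) ν :=
  (integrable_const (1 : ℝ)).mono (by fun_prop)
    (ae_of_all _ fun x ↦ by simp [mul_assoc, ← Complex.ofReal_mul])

theorem charFun_compoundPoisson_real (ν : Measure ℝ) [IsFiniteMeasure ν] (q : ℝ) :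
    charFun (compoundPoisson ν) q
      = Complex.exp (∫ x, (Complex.exp (Complex.I * q * x) - 1) ∂ν) := by
  rw [charFun_compoundPoisson, integral_sub (integrable_exp_I_mul ν q) (integrable_const _),
    charFun_apply_real, integral_const]
  simp [mul_comm, mul_left_comm]

variable {b : ℝ} {ν : Measure ℝ} [IsFiniteMeasure ν]

theorem IsTiltSymmetric.convPow (h : IsTiltSymmetric b ν) (n : ℕ) :
    IsTiltSymmetric b (convPow ν n) := by
  induction n with
  | zero => exact IsTiltSymmetric.dirac_zero b
  | succ n ih => exact ih.conv h

theorem IsTiltSymmetric.compoundPoisson (h : IsTiltSymmetric b ν) :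
    IsTiltSymmetric b (compoundPoisson ν) :=
  IsTiltSymmetric.sum fun n ↦ (h.convPow n).smul _

end CompoundPoisson

section JumpMeasure

@[fun_prop]
theorem measurable_trunc : Measurable trunc :=
  Measurable.ite (measurableSet_lt (by fun_prop) (by fun_prop)) measurable_id measurable_const

theorem abs_trunc_le_one (y : ℝ) : |trunc y| ≤ 1 := by
  unfold trunc
  split_ifs with h
  · exact h.le
  · simp

theorem trunc_neg (y : ℝ) : trunc (-y) = -trunc y := by
  unfold trunc
  rw [abs_neg]
  split_ifs <;> simp

theorem trunc_sq_le (y : ℝ) : trunc y ^ 2 ≤ min 1 (y ^ 2) := by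
  refine le_min ((sq_le_one_iff_abs_le_one _).2 (abs_trunc_le_one y)) ?_
  unfold trunc
  split_ifs
  · rfl
  · simpa using sq_nonneg y

@[fun_prop]
theorem measurable_lkIntegrand (z : ℂ) : Measurable (lkIntegrand z) := by
  unfold lkIntegrand
  fun_prop

theorem lkIntegrand_apply_zero (z : ℂ) : lkIntegrand z 0 = 0 := by
  simp [lkIntegrand, trunc]

theorem lkIntegrand_two_mul_I (b y : ℝ) :
    lkIntegrand (2 * b * Complex.I) y
      = ((Real.exp (-2 * b * y) - 1 + 2 * b * trunc y : ℝ) : ℂ) := by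
  have : Complex.I * (2 * b * Complex.I) = -2 * b := by
    linear_combination (2 * b : ℂ) * Complex.I_sq
  rw [lkIntegrand, this]
  push_cast
  ring

theorem norm_lkIntegrand_le (z : ℂ) {y : ℝ} (hy : |y| < 1) :
    ‖lkIntegrand z y‖ ≤ ‖z‖ ^ 2 * Real.exp ‖z‖ * y ^ 2 := by
  have htaylor := Complex.norm_exp_sub_sum_le_norm_mul_exp (Complex.I * z * y) 2
  simp only [Finset.sum_range_succ, Finset.sum_range_zero, pow_zero, pow_one, Nat.factorial,
    norm_mul, Complex.norm_I, one_mul, Complex.norm_real, Real.norm_eq_abs, zero_add,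
    Nat.cast_one, div_one, mul_one, ← sub_sub, mul_pow, sq_abs] at htaylor
  rw [lkIntegrand, trunc, if_pos hy]
  calc _ ≤ ‖z‖ ^ 2 * y ^ 2 * Real.exp (‖z‖ * |y|) := htaylor
    _ ≤ ‖z‖ ^ 2 * y ^ 2 * Real.exp ‖z‖ := by
      gcongr
      exact mul_le_of_le_one_right (norm_nonneg _) hy.le
    _ = _ := by ring

/-- The complement of the open ball of radius `1 / (n + 1)` around `0`: the jumps kept at the `n`-th
stage when the small jumps are cut off. -/
def awayFromZero (n : ℕ) : Set ℝ := {y | 1 / ((n : ℝ) + 1) ≤ |y|}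

theorem measurableSet_awayFromZero (n : ℕ) : MeasurableSet (awayFromZero n) :=
  measurableSet_le (by fun_prop) (by fun_prop)

theorem neg_preimage_awayFromZero (n : ℕ) :
    (fun x ↦ -x) ⁻¹' awayFromZero n = awayFromZero n := by
  simp [awayFromZero]

theorem monotone_awayFromZero : Monotone awayFromZero := fun _ _ hmn _ hy ↦
  (Nat.one_div_le_one_div (α := ℝ) hmn).trans hy

theorem iUnion_awayFromZero : ⋃ n, awayFromZero n = {0}ᶜ := by
  ext y
  simp only [Set.mem_iUnion, Set.mem_compl_iff, Set.mem_singleton_iff]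
  refine ⟨fun ⟨n, hn⟩ hy ↦ ?_, fun hy ↦ ?_⟩
  · have : 1 / ((n : ℝ) + 1) ≤ |y| := hn
    rw [hy, abs_zero] at this
    exact this.not_gt Nat.one_div_pos_of_nat
  · obtain ⟨n, hn⟩ := exists_nat_one_div_lt (abs_pos.2 hy)
    exact ⟨n, hn.le⟩

theorem tendsto_setIntegral_awayFromZero {E : Type*} [NormedAddCommGroup E] [NormedSpace ℝ E]
    {ν : Measure ℝ} {g : ℝ → E} (hg : Integrable g ν) (hg0 : g 0 = 0) :
    Tendsto (fun n ↦ ∫ y in awayFromZero n, g y ∂ν) atTop (𝓝 (∫ y, g y ∂ν)) := by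
  have key := tendsto_setIntegral_of_monotone measurableSet_awayFromZero monotone_awayFromZero
    (hg.integrableOn (s := ⋃ n, awayFromZero n))
  rwa [iUnion_awayFromZero, setIntegral_eq_integral_of_forall_compl_eq_zero] at key
  simpa using hg0

theorem IsTiltSymmetric.restrict_awayFromZero {b : ℝ} {ν : Measure ℝ} (h : IsTiltSymmetric b ν)
    (n : ℕ) : IsTiltSymmetric b (ν.restrict (awayFromZero n)) :=
  h.restrict (measurableSet_awayFromZero n) (neg_preimage_awayFromZero n)

/-- The tilt-symmetrisation of the truncation function `h`. It has the same integral as `h` against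
tilt-symmetric measures restricted to a symmetric set away from `0`, and, being of order `y²` at
`0`, it is integrable against the whole jump measure. -/
noncomputable def tiltSymmTrunc (b y : ℝ) : ℝ := trunc y * (1 - Real.exp (-2 * b * y)) / 2

theorem tiltSymmTrunc_apply_zero (b : ℝ) : tiltSymmTrunc b 0 = 0 := by simp [tiltSymmTrunc]

namespace IsLevyMeasure

variable {ν : Measure ℝ} {b : ℝ}

theorem integrable_min (h : IsLevyMeasure ν) : Integrable (fun y : ℝ ↦ min 1 (y ^ 2)) ν := by
  refine ⟨by fun_prop, ?_⟩
  rw [hasFiniteIntegral_iff_ofReal (ae_of_all _ fun y ↦ le_min zero_le_one (sq_nonneg y))]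
  exact h.lintegral_lt_top

theorem isFiniteMeasure_restrict (h : IsLevyMeasure ν) (n : ℕ) :
    IsFiniteMeasure (ν.restrict (awayFromZero n)) := by
  have hpos : 0 < 1 / ((n : ℝ) + 1) := Nat.one_div_pos_of_nat
  have hle : 1 / ((n : ℝ) + 1) ≤ 1 := by simpa using Nat.one_div_le_one_div (α := ℝ) n.zero_le
  refine MeasureTheory.isFiniteMeasure_restrict.2 ((measure_mono fun y hy ↦ ?_).trans_lt
    (h.integrable_min.measure_ge_lt_top (pow_pos hpos 2))).ne
  refine le_min (pow_le_one₀ hpos.le hle) ?_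
  rw [← sq_abs y]
  exact pow_le_pow_left₀ hpos.le hy 2

theorem integrable_trunc (h : IsLevyMeasure ν) (n : ℕ) :
    Integrable trunc (ν.restrict (awayFromZero n)) := by
  have := h.isFiniteMeasure_restrict n
  exact (integrable_const (1 : ℝ)).mono (by fun_prop)
    (ae_of_all _ fun y ↦ by simpa using abs_trunc_le_one y)

theorem integrable_trunc_sq (h : IsLevyMeasure ν) : Integrable (fun y ↦ trunc y ^ 2) ν :=
  h.integrable_min.mono' (by fun_prop) (ae_of_all _ fun y ↦ by simpa using trunc_sq_le y)

theorem integrable_lkIntegrand (h : IsLevyMeasure ν) {z : ℂ}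
    (hz : Integrable (fun y : ℝ ↦ Complex.exp (Complex.I * z * y))
      (ν.restrict (awayFromZero 0))) : Integrable (lkIntegrand z) ν := by
  have := h.isFiniteMeasure_restrict 0
  rw [← integrableOn_univ, ← Set.union_compl_self (awayFromZero 0), integrableOn_union]
  constructor
  · exact (hz.sub (integrable_const 1)).sub ((h.integrable_trunc 0).ofReal.const_mul _)
  · refine (h.integrable_min.const_mul (‖z‖ ^ 2 * Real.exp ‖z‖)).integrableOn.mono'
      (by fun_prop) ((ae_restrict_iff' (measurableSet_awayFromZero 0).compl).2
        (ae_of_all _ fun y hy ↦ ?_))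
    have hy : |y| < 1 := by simpa [awayFromZero] using hy
    rw [min_eq_right ((sq_le_one_iff_abs_le_one y).2 hy.le)]
    exact norm_lkIntegrand_le z hy

theorem integrable_lkIntegrand_real (h : IsLevyMeasure ν) (q : ℝ) :
    Integrable (lkIntegrand q) ν := by
  have := h.isFiniteMeasure_restrict 0
  exact h.integrable_lkIntegrand (integrable_exp_I_mul _ q)

theorem integrable_lkIntegrand_two_mul_I (h : IsLevyMeasure ν) (hb : IsTiltSymmetric b ν) :
    Integrable (lkIntegrand (2 * b * Complex.I)) ν := by
  have := h.isFiniteMeasure_restrict 0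
  refine h.integrable_lkIntegrand
    ((hb.restrict_awayFromZero 0).integrable_exp.ofReal.congr (ae_of_all _ fun y ↦ ?_))
  simp only [Complex.coe_algebraMap, Complex.ofReal_exp]
  congr 1
  push_cast
  linear_combination (-2 * b * y : ℂ) * Complex.I_sq

theorem integrable_exp_sub_one_add_trunc (h : IsLevyMeasure ν) (hb : IsTiltSymmetric b ν) :
    Integrable (fun y ↦ Real.exp (-2 * b * y) - 1 + 2 * b * trunc y) ν :=
  (h.integrable_lkIntegrand_two_mul_I hb).re.congr (ae_of_all _ fun y ↦
    (congrArg Complex.re (lkIntegrand_two_mul_I b y)).trans (Complex.ofReal_re _))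

theorem integrable_tiltSymmTrunc (h : IsLevyMeasure ν) (hb : IsTiltSymmetric b ν) :
    Integrable (tiltSymmTrunc b) ν := by
  have hlk : Integrable (fun y ↦ trunc y * (Real.exp (-2 * b * y) - 1 + 2 * b * trunc y)) ν :=
    (h.integrable_exp_sub_one_add_trunc hb).bdd_mul (c := 1) (by fun_prop)
      (ae_of_all _ abs_trunc_le_one)
  refine ((h.integrable_trunc_sq.const_mul b).sub (hlk.div_const 2)).congr (ae_of_all _ fun y ↦ ?_)
  simp only [Pi.sub_apply, tiltSymmTrunc]
  ring

theorem setIntegral_trunc (h : IsLevyMeasure ν) (hb : IsTiltSymmetric b ν) (n : ℕ) :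
    ∫ y in awayFromZero n, trunc y ∂ν = ∫ y in awayFromZero n, tiltSymmTrunc b y ∂ν := by
  rw [← sub_eq_zero, ← integral_sub (h.integrable_trunc n)
    (h.integrable_tiltSymmTrunc hb).integrableOn]
  refine (hb.restrict_awayFromZero n).integral_eq_zero fun y ↦ ?_
  simp only [tiltSymmTrunc, trunc_neg, mul_neg, neg_mul, neg_neg, Real.exp_neg]
  field_simp
  ring

theorem integral_lkIntegrand_two_mul_I (h : IsLevyMeasure ν) (hb : IsTiltSymmetric b ν) :
    ∫ y, lkIntegrand (2 * b * Complex.I) y ∂ν = ((2 * b * ∫ y, tiltSymmTrunc b y ∂ν : ℝ) : ℂ) := by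
  simp only [lkIntegrand_two_mul_I]
  rw [integral_complex_ofReal, Complex.ofReal_inj, ← sub_eq_zero, ← integral_const_mul,
    ← integral_sub (h.integrable_exp_sub_one_add_trunc hb)
      ((h.integrable_tiltSymmTrunc hb).const_mul _)]
  refine hb.integral_eq_zero fun y ↦ ?_
  simp only [tiltSymmTrunc, trunc_neg, mul_neg, neg_mul, neg_neg, Real.exp_neg]
  field_simp
  ring

end IsLevyMeasure

end JumpMeasure

section Drift

/-- The drift `α` of the paper: what remains of the drift coefficient `a` when the Gaussian part of
the law at time `t` is centred at `bσ²t` and `tiltSymmTrunc` replaces the truncation function. -/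
noncomputable def symmetryDrift (a σ b : ℝ) (ν : Measure ℝ) : ℝ :=
  a - b * σ ^ 2 - ∫ y, tiltSymmTrunc b y ∂ν

theorem symmetryDrift_zero (a σ : ℝ) (ν : Measure ℝ) : symmetryDrift a σ 0 ν = a := by
  simp [symmetryDrift, tiltSymmTrunc]

theorem symmetryDrift_sub (a c σ b : ℝ) (ν : Measure ℝ) :
    symmetryDrift (a - c) σ b ν = symmetryDrift a σ b ν - c := by
  simp only [symmetryDrift]
  ring

theorem charExponent_sub (a c σ : ℝ) (ν : Measure ℝ) (z : ℂ) :
    charExponent (a - c) σ ν z = charExponent a σ ν z - Complex.I * c * z := by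
  simp only [charExponent, Complex.ofReal_sub]
  ring

theorem charExponent_two_mul_I {ν : Measure ℝ} (hν : IsLevyMeasure ν) {b : ℝ}
    (hb : IsTiltSymmetric b ν) (a σ : ℝ) :
    charExponent a σ ν (2 * b * Complex.I) = -(2 * b * symmetryDrift a σ b ν) := by
  rw [charExponent, hν.integral_lkIntegrand_two_mul_I hb, symmetryDrift]
  push_cast
  linear_combination (2 * a * b - 2 * σ ^ 2 * b ^ 2 : ℂ) * Complex.I_sq

/-- The symmetrically compensated approximation of an infinitely divisible law: a Gaussian part of
variance `v` centred at `bv` and the jumps in `awayFromZero n`, occurring at rate `t ν`. -/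
noncomputable def truncatedLaw (b : ℝ) (v : ℝ≥0) (ν : Measure ℝ) (t : ℝ≥0) (n : ℕ) : Measure ℝ :=
  compoundPoisson (t • ν.restrict (awayFromZero n)) ∗ gaussianReal (b * v) v

variable {ν : Measure ℝ} {b : ℝ}

theorem IsLevyMeasure.isProbabilityMeasure_truncatedLaw (hν : IsLevyMeasure ν) (b : ℝ) (v t : ℝ≥0)
    (n : ℕ) : IsProbabilityMeasure (truncatedLaw b v ν t n) := by
  have := hν.isFiniteMeasure_restrict n
  unfold truncatedLaw
  infer_instance

theorem IsLevyMeasure.isTiltSymmetric_truncatedLaw (hν : IsLevyMeasure ν)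
    (hb : IsTiltSymmetric b ν) (v t : ℝ≥0) (n : ℕ) :
    IsTiltSymmetric b (truncatedLaw b v ν t n) := by
  have := hν.isFiniteMeasure_restrict n
  have hjump : IsTiltSymmetric b (t • ν.restrict (awayFromZero n)) :=
    (hb.restrict_awayFromZero n).smul t
  exact hjump.compoundPoisson.conv (.gaussianReal b v)

theorem IsLevyMeasure.setIntegral_exp_sub_one (hν : IsLevyMeasure ν) (hb : IsTiltSymmetric b ν)
    (n : ℕ) (q : ℝ) :
    ∫ y in awayFromZero n, (Complex.exp (Complex.I * q * y) - 1) ∂ν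
      = ∫ y in awayFromZero n, (lkIntegrand q y + Complex.I * q * (tiltSymmTrunc b y : ℂ)) ∂ν := by
  have hlk := (hν.integrable_lkIntegrand_real q).integrableOn (s := awayFromZero n)
  have htst : IntegrableOn (fun y ↦ Complex.I * q * (tiltSymmTrunc b y : ℂ)) (awayFromZero n) ν :=
    ((hν.integrable_tiltSymmTrunc hb).ofReal.const_mul _).integrableOn
  have htrunc : IntegrableOn (fun y ↦ Complex.I * q * (trunc y : ℂ)) (awayFromZero n) ν :=
    (hν.integrable_trunc n).ofReal.const_mul _
  rw [integral_add hlk htst, integral_const_mul, integral_complex_ofReal, ← hν.setIntegral_trunc hb,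
    ← integral_complex_ofReal, ← integral_const_mul, ← integral_add hlk htrunc]
  simp [lkIntegrand]

theorem IsLevyMeasure.charFun_truncatedLaw (hν : IsLevyMeasure ν) (hb : IsTiltSymmetric b ν)
    (v t : ℝ≥0) (n : ℕ) (q : ℝ) :
    charFun (truncatedLaw b v ν t n) q = Complex.exp (t *
        ∫ y in awayFromZero n, (lkIntegrand q y + Complex.I * q * (tiltSymmTrunc b y : ℂ)) ∂ν)
      * Complex.exp (q * (b * v) * Complex.I - v * q ^ 2 / 2) := by
  have := hν.isFiniteMeasure_restrict n
  rw [truncatedLaw, charFun_conv, charFun_compoundPoisson_real, charFun_gaussianReal,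
    integral_smul_nnreal_measure, hν.setIntegral_exp_sub_one hb]
  simp [NNReal.smul_def]

theorem IsLevyMeasure.tendsto_charFun_truncatedLaw (hν : IsLevyMeasure ν)
    (hb : IsTiltSymmetric b ν) (σ : ℝ) (t : ℝ≥0) (q : ℝ) {a : ℝ} (ha : symmetryDrift a σ b ν = 0) :
    Tendsto (fun n ↦ charFun (truncatedLaw b (‖σ‖₊ ^ 2 * t) ν t n) q) atTop
      (𝓝 (Complex.exp (t * charExponent a σ ν q))) := by
  have hlk := hν.integrable_lkIntegrand_real q
  have htst : Integrable (fun y ↦ Complex.I * q * (tiltSymmTrunc b y : ℂ)) ν :=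
    (hν.integrable_tiltSymmTrunc hb).ofReal.const_mul _
  have hlim := tendsto_setIntegral_awayFromZero (hlk.add htst)
    (by simp [lkIntegrand_apply_zero, tiltSymmTrunc_apply_zero])
  have ha' : (a : ℂ) = b * σ ^ 2 + (∫ y, tiltSymmTrunc b y ∂ν : ℝ) := by
    rw [symmetryDrift, sub_sub, sub_eq_zero] at ha
    exact_mod_cast ha
  have hσ : ((‖σ‖₊ ^ 2 * t : ℝ≥0) : ℂ) = σ ^ 2 * t := by
    norm_cast
    simp
  have hexponent : t * charExponent a σ ν q
      = t * ∫ y, (lkIntegrand q y + Complex.I * q * (tiltSymmTrunc b y : ℂ)) ∂ν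
        + (q * (b * (σ ^ 2 * t)) * Complex.I - σ ^ 2 * t * q ^ 2 / 2) := by
    rw [integral_add hlk htst, integral_const_mul, integral_complex_ofReal, charExponent, ha']
    ring
  simp only [hν.charFun_truncatedLaw hb, hσ, hexponent, Complex.exp_add]
  exact (hlim.const_mul (t : ℂ)).cexp.mul_const _

theorem IsLevyMeasure.isTiltSymmetric_of_charFun (hν : IsLevyMeasure ν) (hb : IsTiltSymmetric b ν)
    {a σ : ℝ} (ha : symmetryDrift a σ b ν = 0) (t : ℝ≥0) {ρ : Measure ℝ} [IsProbabilityMeasure ρ]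
    (hρ : ∀ q : ℝ, charFun ρ q = Complex.exp (t * charExponent a σ ν q)) :
    IsTiltSymmetric b ρ := by
  let νs (n : ℕ) : ProbabilityMeasure ℝ :=
    ⟨truncatedLaw b (‖σ‖₊ ^ 2 * t) ν t n, hν.isProbabilityMeasure_truncatedLaw b _ t n⟩
  refine IsTiltSymmetric.of_tendsto (l := atTop) (νs := νs) (ν := ⟨ρ, inferInstance⟩) ?_
    fun n ↦ hν.isTiltSymmetric_truncatedLaw hb _ t n
  refine ProbabilityMeasure.tendsto_iff_tendsto_charFun.2 fun q ↦ ?_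
  simp only [νs, ProbabilityMeasure.coe_mk, hρ]
  exact hν.tendsto_charFun_truncatedLaw hb σ t q ha

end Drift

section Stock

variable {Ω : Type*} {m : MeasurableSpace Ω} {Q : Measure Ω} {X : ℝ≥0 → Ω → ℝ} {T : ℝ≥0}

theorem HasTriplet.isTiltSymmetric_map [IsProbabilityMeasure Q] {μ σ b : ℝ} {ν : Measure ℝ}
    (h : HasTriplet Q X μ σ ν) (hb : IsTiltSymmetric b ν) (hX : AEMeasurable (X T) Q) :
    IsTiltSymmetric b (Q.map fun ω ↦ X T ω - symmetryDrift μ σ b ν * T) := by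
  set α := symmetryDrift μ σ b ν with hα
  have hY : AEMeasurable (fun ω ↦ X T ω - α * T) Q := by fun_prop
  have := Measure.isProbabilityMeasure_map hY
  have hdrift : symmetryDrift (μ - α) σ b ν = 0 := by rw [symmetryDrift_sub, hα, sub_self]
  refine h.levyMeasure.isTiltSymmetric_of_charFun hb hdrift T fun q ↦ ?_
  have hshift : ∀ ω, Complex.exp (q * ((X T ω - α * T : ℝ) : ℂ) * Complex.I)
      = Complex.exp (-(Complex.I * α * q * T)) * Complex.exp (Complex.I * q * X T ω) := fun ω ↦ by
    rw [← Complex.exp_add]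
    congr 1
    push_cast
    ring
  rw [charFun_apply_real, integral_map hY (by fun_prop)]
  simp only [hshift]
  rw [integral_const_mul, h.charFun_eq, ← Complex.exp_add, charExponent_sub, mul_sub]
  congr 1
  ring

theorem stock_eq_mul_exp_sub (S₀ α : ℝ) (ω : Ω) :
    stock S₀ X T ω = S₀ * Real.exp (α * T) * Real.exp (X T ω - α * T) := by
  rw [stock, mul_assoc, ← Real.exp_add, add_sub_cancel]

theorem lintegral_stock_eq_of_isTiltSymmetric {b α S₀ : ℝ} (hX : AEMeasurable (X T) Q)
    (hY : IsTiltSymmetric b (Q.map fun ω ↦ X T ω - α * T)) (hS₀ : 0 < S₀) {f : ℝ → ℝ≥0∞}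
    (hf : Measurable f) :
    ∫⁻ ω, f (stock S₀ X T ω) ∂Q =
      ∫⁻ ω, ENNReal.ofReal ((stock S₀ X T ω / (S₀ * Real.exp (α * T))) ^ (-2 * b)) *
        f (S₀ ^ 2 * Real.exp (2 * α * T) / stock S₀ X T ω) ∂Q := by
  have hreturn (ω : Ω) :
      stock S₀ X T ω / (S₀ * Real.exp (α * T)) = Real.exp (X T ω - α * T) := by
    rw [stock_eq_mul_exp_sub S₀ α, mul_div_cancel_left₀ _ (by positivity)]
  have hreflect (ω : Ω) : S₀ ^ 2 * Real.exp (2 * α * T) / stock S₀ X T ω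
      = S₀ * Real.exp (α * T) * Real.exp (-(X T ω - α * T)) := by
    rw [stock_eq_mul_exp_sub S₀ α, Real.exp_neg, mul_assoc 2, two_mul, Real.exp_add]
    field_simp
  have key := hY.lintegral_comp_neg
    (g := fun x ↦ f (S₀ * Real.exp (α * T) * Real.exp (-x))) (by fun_prop)
  rw [lintegral_map' (by fun_prop) (by fun_prop), lintegral_map' (by fun_prop) (by fun_prop)] at key
  simp only [neg_neg, ← stock_eq_mul_exp_sub, ← hreflect] at key
  simp only [key, hreturn, ← Real.exp_mul, mul_comm]

end Stock

end LevyMarket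

theorem theorem4p1_general {Ω : Type*} {m : MeasurableSpace Ω} (Q : Measure Ω)
    [IsProbabilityMeasure Q] (X : ℝ≥0 → Ω → ℝ) (hX : ∀ t, AEMeasurable (X t) Q)
    (μ σ β : ℝ) (Pi₀ : Measure ℝ) (hsymm : LevyMarket.IsSymmetricMeasure Pi₀)
    (htriplet : LevyMarket.HasTriplet Q X μ σ (LevyMarket.expTilt β Pi₀)) :
    Integrable (LevyMarket.lkIntegrand (2 * β * Complex.I)) (LevyMarket.expTilt β Pi₀) ∧
    ∃ α : ℝ,
      (α : ℂ) = (if β = 0 then (μ : ℂ) else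
        -LevyMarket.charExponent μ σ (LevyMarket.expTilt β Pi₀) (2 * β * Complex.I) / (2 * β)) ∧
      ∀ (S₀ : ℝ) (T : ℝ≥0) (f : ℝ → ℝ≥0∞), 0 < S₀ → Measurable f →
        ∫⁻ ω, f (LevyMarket.stock S₀ X T ω) ∂Q =
          ∫⁻ ω, ENNReal.ofReal
            ((LevyMarket.stock S₀ X T ω / (S₀ * Real.exp (α * T))) ^ (-2 * β)) *
              f (S₀ ^ 2 * Real.exp (2 * α * T) / LevyMarket.stock S₀ X T ω) ∂Q := by
  have hlevy := htriplet.levyMeasure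
  have htilt := hsymm.isTiltSymmetric_expTilt β
  refine ⟨hlevy.integrable_lkIntegrand_two_mul_I htilt,
    LevyMarket.symmetryDrift μ σ β (LevyMarket.expTilt β Pi₀), ?_, fun S₀ T f hS₀ hf ↦ ?_⟩
  · split_ifs with hβ
    · rw [hβ, LevyMarket.symmetryDrift_zero]
    · have : (2 * β : ℂ) ≠ 0 := by exact_mod_cast mul_ne_zero two_ne_zero hβ
      rw [LevyMarket.charExponent_two_mul_I hlevy htilt, neg_neg, mul_div_cancel_left₀ _ this]
  · exact LevyMarket.lintegral_stock_eq_of_isTiltSymmetric (hX T)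
      (htriplet.isTiltSymmetric_map htilt (hX T)) hS₀ hf

theorem theorem4p1 {Ω : Type*} {m : MeasurableSpace Ω} (Q : Measure Ω) [IsProbabilityMeasure Q]
    (ℱ : Filtration ℝ≥0 m) (X : ℝ≥0 → Ω → ℝ) (hX : LevyMarket.IsLevyProcess ℱ Q X)
    (μ σ β : ℝ) (Pi₀ : Measure ℝ) (hsymm : LevyMarket.IsSymmetricMeasure Pi₀)
    (htriplet : LevyMarket.HasTriplet Q X μ σ (LevyMarket.expTilt β Pi₀))
    (hβ : β ≠ -1 / 2) :
    Integrable (LevyMarket.lkIntegrand (2 * β * Complex.I)) (LevyMarket.expTilt β Pi₀) ∧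
    ∃ α : ℝ,
      (α : ℂ) = (if β = 0 then (μ : ℂ) else
        -LevyMarket.charExponent μ σ (LevyMarket.expTilt β Pi₀) (2 * β * Complex.I) / (2 * β)) ∧
      ∀ (S₀ : ℝ) (T : ℝ≥0) (f : ℝ → ℝ), 0 < S₀ → Measurable f → (∀ x, 0 ≤ f x) →
        ∫⁻ ω, ENNReal.ofReal (f (LevyMarket.stock S₀ X T ω)) ∂Q =
          ∫⁻ ω, ENNReal.ofReal
            ((LevyMarket.stock S₀ X T ω / (S₀ * Real.exp (α * T))) ^ (-2 * β) *
              f (S₀ ^ 2 * Real.exp (2 * α * T) / LevyMarket.stock S₀ X T ω)) ∂Q := by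
  have hmeas (t : ℝ≥0) : AEMeasurable (X t) Q :=
    ((hX.adapted t).mono (ℱ.le t) le_rfl).aemeasurable
  obtain ⟨hint, α, hα, hmain⟩ := theorem4p1_general Q X hmeas μ σ β Pi₀ hsymm htriplet
  refine ⟨hint, α, hα, fun S₀ T f hS₀ hf hf0 ↦ ?_⟩
  have hpow (ω : Ω) :
      0 ≤ (LevyMarket.stock S₀ X T ω / (S₀ * Real.exp (α * T))) ^ (-2 * β) := by
    unfold LevyMarket.stock
    positivity
  simpa only [ENNReal.ofReal_mul (hpow _)] using
    hmain S₀ T (fun x ↦ ENNReal.ofReal (f x)) hS₀ hf.ennreal_ofReal
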